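/- Let $(X,\mathcal F,\mu)$ be a $\sigma$-finite measure space and $\mathcal A\subseteq\mathcal F$ a $\sigma$-subalgebra such that $\mu|_{\mathcal A}$ is $\sigma$-finite. Let $E$ be the conditional expectation with respect to $\mathcal A$, defined for all $\mathcal F$-measurable $f\ge 0$ with values in $[0,\infty]$ and, by linearity, on $\mathcal D(E)$, the set of all $\mathcal F$-measurable $f:X\to\mathbb C$ with $E(|f|)<\infty$ a.e. Functions are identified when they agree almost everywhere, and $L^2(\mathcal F)=L^2(X,\mathcal F,\mu)$ is the complex Hilbert space. For a bounded operator $T$ on a complex Hilbert space $\mathcal H$ with spectral radius $r(T)$ and for $m\ge1$, put $$d_m=\frac1{\frac1m+r(T)},\qquad R_m=\Big(\sum_{n=0}^\infty d_m^{2n}\,T^{*n}T^n\Big)^{1/2},$$ (the series converges in norm and $R_m$ is positive and invertible), and let $$Q_T=\{S\in\mathcal B(\mathcal H):\ \|R_mSR_m^{-1}\|\to0\ \text{ as } m\to\infty\}.$$ Let $w,u\in\mathcal D(E)$ with $E(|u|^2)\in L^\infty(\mathcal A)$, and suppose that $T=M_wEM_u$, $Tf=wE(uf)$, is a bounded operator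 on $L^2(\mathcal F)$. Suppose that $u\ge0$ a.e. and that $E(u)\ge\delta$ a.e. for some constant $\delta>0$. Then $EM_u$, $f\mapsto E(uf)$, is a bounded operator on $L^2(\mathcal F)$, and it majorizes every $S\in Q_T$: for every $S\in Q_T$ there is a constant $M>0$ such that $$\|Sf\|\le M\,\|E(uf)\|\qquad\text{for all } f\in L^2(\mathcal F).$$ -/

import Mathlib

open MeasureTheory Filter Topology
open scoped ENNReal NNReal ComplexOrder

noncomputable section

namespace SpectralRadiusAlgebra

section Hilbert

variable {H : Type*} [NormedAddCommGroup H] [InnerProductSpace ℂ H] [CompleteSpace H]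

/-- The scalar `d_m = 1 / (1/m + r(T))`, where `r(T)` is the spectral radius of `T`. -/
def dCoeff (T : H →L[ℂ] H) (m : ℕ) : ℝ :=
  1 / (1 / (m : ℝ) + (spectralRadius ℂ T).toReal)

/-- The positive operator `R_m(T) = (∑ₙ d_m ^ (2n) (T*)ⁿ Tⁿ) ^ (1/2)`; for `m ≥ 1` the series
converges in operator norm. -/
def Rop (T : H →L[ℂ] H) (m : ℕ) : H →L[ℂ] H :=
  CFC.sqrt (∑' n : ℕ, ((dCoeff T m : ℂ) ^ (2 * n)) • ((ContinuousLinearMap.adjoint T) ^ n * T ^ n))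

/-- `Q_T`: the bounded operators `S` on `H` with `‖R_m S R_m⁻¹‖ → 0` as `m → ∞`. -/
def Qset (T : H →L[ℂ] H) : Set (H →L[ℂ] H) :=
  {S | Tendsto (fun m : ℕ => ‖Rop T m * S * Ring.inverse (Rop T m)‖) atTop (𝓝 0)}

end Hilbert

/-- `T` majorizes `S`: there is `M > 0` with `‖S x‖ ≤ M ‖T x‖` for all `x`. -/
def Majorizes {E F G : Type*} [NormedAddCommGroup E] [NormedSpace ℂ E]
    [NormedAddCommGroup F] [NormedSpace ℂ F] [NormedAddCommGroup G] [NormedSpace ℂ G]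
    (T : E →L[ℂ] F) (S : E →L[ℂ] G) : Prop :=
  ∃ M : ℝ, 0 < M ∧ ∀ x : E, ‖S x‖ ≤ M * ‖T x‖

section CondExp

variable {X : Type*} {mF : MeasurableSpace X}

/-- `f ∈ 𝓓(E)`: `f` is measurable (up to null sets) and `E(|f|) < ∞` almost everywhere.
Here `condLExp mA μ` is the conditional expectation of `[0, ∞]`-valued functions. -/
def Conditionable (mA : MeasurableSpace X) (μ : Measure[mF] X) (f : X → ℂ) : Prop :=
  AEStronglyMeasurable[mF] f μ ∧ ∀ᵐ x ∂μ, condLExp mA μ (fun y => ‖f y‖ₑ) x < ∞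

/-- The conditional expectation `E(f)` of a real function with `E(|f|) < ∞` a.e. (`f` need not be
integrable), namely `E(f⁺) - E(f⁻)`. -/
def condEReal (mA : MeasurableSpace X) (μ : Measure[mF] X) (f : X → ℝ) (x : X) : ℝ :=
  (condLExp mA μ (fun y => ENNReal.ofReal (f y)) x).toReal -
    (condLExp mA μ (fun y => ENNReal.ofReal (-f y)) x).toReal

/-- The conditional expectation `E(f) = E(Re f) + i E(Im f)` of a complex function in `𝓓(E)`. -/
def condE (mA : MeasurableSpace X) (μ : Measure[mF] X) (f : X → ℂ) (x : X) : ℂ :=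
  ⟨condEReal mA μ (fun y => (f y).re) x, condEReal mA μ (fun y => (f y).im) x⟩

/-- The bounded operator `T` on `L²(μ)` is the weighted conditional expectation operator
`M_w E M_u`, that is, `T f = w E(u f)` for every `f ∈ L²(μ)`. -/
def IsWCE (mA : MeasurableSpace X) (μ : Measure[mF] X) (w u : X → ℂ)
    (T : Lp ℂ 2 μ →L[ℂ] Lp ℂ 2 μ) : Prop :=
  ∀ f : Lp ℂ 2 μ, Conditionable mA μ (fun x => u x * f x) ∧
    T f =ᵐ[μ] fun x => w x * condE mA μ (fun y => u y * f y) x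

end CondExp

end SpectralRadiusAlgebra

end

/-!
Write `E` for the conditional expectation and `A = EM_u`. Up to the inclusion `L²(𝓐) ⊆ L²(𝓕)`,
`A` is the adjoint of the multiplication `g ↦ ū g` from `L²(𝓐)` to `L²(𝓕)`, which is bounded because
`‖ū g‖² = ∫ E(|u|²) |g|²`. Since `u` and `u f` need not be integrable, `E` is compared with the
Bochner conditional expectation on `𝓐`-measurable sets of finite measure.

As `R_m² ≥ 1`, and `R_m² x = x` for `x ∈ ker T`, every `S ∈ Q_T` satisfies
`‖S x‖ ≤ ‖R_m S R_m⁻¹‖ ‖x‖ → 0` on `ker T ⊇ ker A`. The function `g = E(u f) / E(u)`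
satisfies `A g = A f` and `‖g‖ ≤ δ⁻¹ ‖A f‖`, so `‖S f‖ = ‖S g‖ ≤ ‖S‖ δ⁻¹ ‖A f‖`.
-/

namespace SpectralRadiusAlgebra

section BanachAlgebra

variable {B : Type*} [NormedRing B] [NormedAlgebra ℂ B]

lemma eventually_norm_pow_le_of_spectralRadius_lt [CompleteSpace B] {b : B} {r : ℝ}
    (hb : spectralRadius ℂ b < ENNReal.ofReal r) : ∀ᶠ n : ℕ in atTop, ‖b ^ n‖ ≤ r ^ n := by
  have hr : 0 < r := ENNReal.ofReal_pos.1 (bot_le.trans_lt hb)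
  filter_upwards [(spectrum.pow_norm_pow_one_div_tendsto_nhds_spectralRadius b).eventually_lt_const
    hb, eventually_ne_atTop 0] with n hn hn0
  have hroot : ‖b ^ n‖ ^ (1 / n : ℝ) < r := (ENNReal.ofReal_lt_ofReal_iff hr).1 hn
  calc ‖b ^ n‖ = (‖b ^ n‖ ^ (1 / n : ℝ)) ^ n := by
        rw [one_div, Real.rpow_inv_natCast_pow (norm_nonneg _) hn0]
    _ ≤ r ^ n := by gcongr

lemma spectralRadius_ne_top [CompleteSpace B] (b : B) : spectralRadius ℂ b ≠ ∞ := by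
  refine ne_top_of_le_ne_top ?_ (spectrum.spectralRadius_le_pow_nnnorm_pow_one_div ℂ b 0)
  simp [ENNReal.mul_ne_top]

open scoped Pointwise in
lemma spectralRadius_smul_le {c : ℂ} (hc : c ≠ 0) (b : B) :
    spectralRadius ℂ (c • b) ≤ ‖c‖ₑ * spectralRadius ℂ b := by
  refine iSup₂_le fun z hz => ?_
  obtain ⟨y, hy, rfl⟩ : z ∈ Units.mk0 c hc • spectrum ℂ b := by
    rw [← spectrum.unit_smul_eq_smul]
    exact hz
  change ‖c * y‖ₑ ≤ _
  rw [enorm_mul]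
  gcongr
  exact le_iSup₂ (f := fun z (_ : z ∈ spectrum ℂ b) => (‖z‖₊ : ℝ≥0∞)) y hy

end BanachAlgebra

section CStarAlgebra

variable {B : Type*} [CStarAlgebra B]

lemma summable_star_pow_mul_pow {b : B} (hb : spectralRadius ℂ b < 1) :
    Summable fun n : ℕ => star (b ^ n) * b ^ n := by
  obtain ⟨r, hbr, hr⟩ := ENNReal.lt_iff_exists_nnreal_btwn.1 hb
  have hr1 : (r : ℝ) < 1 := by exact_mod_cast hr
  refine .of_norm_bounded_eventually_nat (g := fun n => ((r : ℝ) ^ 2) ^ n)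
    (summable_geometric_of_lt_one (by positivity) (pow_lt_one₀ r.2 hr1 two_ne_zero)) ?_
  rw [← ENNReal.ofReal_coe_nnreal] at hbr
  filter_upwards [eventually_norm_pow_le_of_spectralRadius_lt hbr] with n hn
  calc ‖star (b ^ n) * b ^ n‖ = ‖b ^ n‖ ^ 2 := by rw [CStarRing.norm_star_mul_self, sq]
    _ ≤ ((r : ℝ) ^ n) ^ 2 := by gcongr
    _ = ((r : ℝ) ^ 2) ^ n := pow_right_comm ..

lemma one_le_tsum_star_pow_mul_pow [PartialOrder B] [StarOrderedRing B] {b : B}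
    (hb : spectralRadius ℂ b < 1) : 1 ≤ ∑' n : ℕ, star (b ^ n) * b ^ n := by
  rw [(summable_star_pow_mul_pow hb).tsum_eq_zero_add, pow_zero, star_one, one_mul]
  exact le_add_of_nonneg_right (tsum_nonneg fun n => star_mul_self_nonneg _)

end CStarAlgebra

lemma majorizes_of_forall_exists_apply_eq {E F G : Type*} [NormedAddCommGroup E] [NormedSpace ℂ E]
    [NormedAddCommGroup F] [NormedSpace ℂ F] [NormedAddCommGroup G] [NormedSpace ℂ G]
    {A : E →L[ℂ] F} {S : E →L[ℂ] G} {K : ℝ}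
    (hA : ∀ x, ∃ y, A y = A x ∧ ‖y‖ ≤ K * ‖A x‖) (hS : ∀ x, A x = 0 → S x = 0) :
    Majorizes A S := by
  refine ⟨‖S‖ * |K| + 1, by positivity, fun x => ?_⟩
  obtain ⟨y, hyx, hy⟩ := hA x
  have hSyx : S y = S x := by
    rw [← sub_eq_zero, ← map_sub, hS _ (by rw [map_sub, hyx, sub_self])]
  calc ‖S x‖ = ‖S y‖ := by rw [hSyx]
    _ ≤ ‖S‖ * ‖y‖ := S.le_opNorm y
    _ ≤ ‖S‖ * (|K| * ‖A x‖) := by gcongr; exact hy.trans (by gcongr; exact le_abs_self K)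
    _ ≤ (‖S‖ * |K| + 1) * ‖A x‖ := by linarith [norm_nonneg (A x)]

section Hilbert

variable {H : Type*} [NormedAddCommGroup H] [InnerProductSpace ℂ H] [CompleteSpace H]

lemma norm_sqrt_apply_sq {P : H →L[ℂ] H} (hP : 0 ≤ P) (x : H) :
    ‖CFC.sqrt P x‖ ^ 2 = RCLike.re (inner ℂ (P x) x) := by
  have hsa : IsSelfAdjoint (CFC.sqrt P) := .of_nonneg (CFC.sqrt_nonneg P)
  conv_rhs => rw [← CFC.sqrt_mul_sqrt_self P hP, mul_apply_eq_comp,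
    ← ContinuousLinearMap.adjoint_inner_right, hsa.adjoint_eq, inner_self_eq_norm_sq]

lemma norm_le_norm_sqrt_apply {P : H →L[ℂ] H} (hP : 1 ≤ P) (x : H) : ‖x‖ ≤ ‖CFC.sqrt P x‖ := by
  have h := ((ContinuousLinearMap.le_def _ _).1 hP).re_inner_nonneg_left x
  rw [sub_apply, inner_sub_left, map_sub, one_apply_eq_self, inner_self_eq_norm_sq, sub_nonneg,
    ← norm_sqrt_apply_sq (zero_le_one.trans hP)] at h
  exact (sq_le_sq₀ (norm_nonneg _) (norm_nonneg _)).1 h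

lemma norm_sqrt_apply_of_apply_eq_self {P : H →L[ℂ] H} (hP : 0 ≤ P) {x : H} (hx : P x = x) :
    ‖CFC.sqrt P x‖ = ‖x‖ := by
  rw [← sq_eq_sq₀ (norm_nonneg _) (norm_nonneg _), norm_sqrt_apply_sq hP, hx, inner_self_eq_norm_sq]

variable {T S : H →L[ℂ] H} {m : ℕ}

lemma Rop_eq_sqrt_tsum (T : H →L[ℂ] H) (m : ℕ) :
    Rop T m =
      CFC.sqrt (∑' n : ℕ, star (((dCoeff T m : ℂ) • T) ^ n) * ((dCoeff T m : ℂ) • T) ^ n) := by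
  unfold Rop
  congr 2 with n : 1
  rw [smul_pow, star_smul, star_pow, star_pow, ContinuousLinearMap.star_eq_adjoint,
    smul_mul_smul_comm, RCLike.star_def, Complex.conj_ofReal, ← pow_add, two_mul]

lemma spectralRadius_dCoeff_smul_lt_one (T : H →L[ℂ] H) (hm : m ≠ 0) :
    spectralRadius ℂ ((dCoeff T m : ℂ) • T) < 1 := by
  have hm' : 0 < 1 / (m : ℝ) := by positivity
  have hd : 0 < dCoeff T m := by unfold dCoeff; positivity
  calc spectralRadius ℂ ((dCoeff T m : ℂ) • T)
      ≤ ‖(dCoeff T m : ℂ)‖ₑ * spectralRadius ℂ T :=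
        spectralRadius_smul_le (Complex.ofReal_ne_zero.2 hd.ne') T
    _ = ENNReal.ofReal (dCoeff T m * (spectralRadius ℂ T).toReal) := by
        rw [ENNReal.ofReal_mul hd.le, ENNReal.ofReal_toReal (spectralRadius_ne_top T),
          ← ofReal_norm, Complex.norm_of_nonneg hd.le]
    _ < 1 := by
        rw [ENNReal.ofReal_lt_one, dCoeff, one_div_mul_eq_div, div_lt_one (by positivity)]
        exact lt_add_of_pos_left _ hm'

lemma isUnit_Rop (T : H →L[ℂ] H) (hm : m ≠ 0) : IsUnit (Rop T m) := by
  have h := one_le_tsum_star_pow_mul_pow (spectralRadius_dCoeff_smul_lt_one T hm)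
  rw [Rop_eq_sqrt_tsum, CFC.isUnit_sqrt_iff _ (zero_le_one.trans h)]
  exact CStarAlgebra.isUnit_of_le 1 h

lemma norm_le_norm_Rop_apply (T : H →L[ℂ] H) (hm : m ≠ 0) (x : H) : ‖x‖ ≤ ‖Rop T m x‖ := by
  rw [Rop_eq_sqrt_tsum]
  exact norm_le_norm_sqrt_apply
    (one_le_tsum_star_pow_mul_pow (spectralRadius_dCoeff_smul_lt_one T hm)) x

lemma tsum_star_pow_mul_pow_apply_of_apply_eq_zero (hT : spectralRadius ℂ T < 1) {x : H}
    (hx : T x = 0) : (∑' n : ℕ, star (T ^ n) * T ^ n) x = x := by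
  have hsum := (summable_star_pow_mul_pow hT).hasSum.mapL (ContinuousLinearMap.apply ℂ H x)
  refine hsum.unique ?_
  convert hasSum_single 0 fun n hn => ?_
  · simp
  · obtain ⟨k, rfl⟩ := Nat.exists_eq_succ_of_ne_zero hn
    simp [pow_succ, hx]

lemma norm_Rop_apply_of_apply_eq_zero (hm : m ≠ 0) {x : H} (hx : T x = 0) :
    ‖Rop T m x‖ = ‖x‖ := by
  have hr := spectralRadius_dCoeff_smul_lt_one T hm
  rw [Rop_eq_sqrt_tsum]
  exact norm_sqrt_apply_of_apply_eq_self (zero_le_one.trans (one_le_tsum_star_pow_mul_pow hr))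
    (tsum_star_pow_mul_pow_apply_of_apply_eq_zero hr (by simp [hx]))

lemma norm_apply_le_of_apply_eq_zero (hm : m ≠ 0) {x : H} (hx : T x = 0) :
    ‖S x‖ ≤ ‖Rop T m * S * Ring.inverse (Rop T m)‖ * ‖x‖ :=
  calc ‖S x‖ ≤ ‖Rop T m (S x)‖ := norm_le_norm_Rop_apply T hm _
    _ = ‖(Rop T m * S * Ring.inverse (Rop T m)) (Rop T m x)‖ := by
      rw [← mul_apply_eq_comp (_ * _ * _), mul_assoc, Ring.inverse_mul_cancel _ (isUnit_Rop T hm),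
        mul_one, mul_apply_eq_comp]
    _ ≤ ‖Rop T m * S * Ring.inverse (Rop T m)‖ * ‖Rop T m x‖ := ContinuousLinearMap.le_opNorm _ _
    _ = _ := by rw [norm_Rop_apply_of_apply_eq_zero hm hx]

lemma apply_eq_zero_of_mem_Qset (hS : S ∈ Qset T) {x : H} (hx : T x = 0) : S x = 0 := by
  have hlim : Tendsto (fun m => ‖Rop T m * S * Ring.inverse (Rop T m)‖ * ‖x‖) atTop (𝓝 0) := by
    simpa only [zero_mul] using Tendsto.mul_const ‖x‖ hS
  refine norm_le_zero_iff.1 (ge_of_tendsto hlim ?_)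
  filter_upwards [eventually_ne_atTop 0] with m hm using norm_apply_le_of_apply_eq_zero hm hx

end Hilbert

section CondExp

variable {X : Type*} {mA mF : MeasurableSpace X} {μ : Measure[mF] X} {f g : X → ℂ} {s : Set X}

/-- `f` is integrable over every `mA`-measurable set of finite measure. -/
def IntegrableOnFinite (mA : MeasurableSpace X) (μ : Measure[mF] X) (f : X → ℂ) : Prop :=
  ∀ s, MeasurableSet[mA] s → μ s < ∞ → IntegrableOn f s μ

lemma measurable_condE (f : X → ℂ) : Measurable[mA] (condE mA μ f) := by
  have hre (h : X → ℝ) : Measurable[mA] (condEReal mA μ h) :=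
    (measurable_condLExp mA μ _).ennreal_toReal.sub (measurable_condLExp mA μ _).ennreal_toReal
  exact Complex.measurableEquivRealProd.symm.measurable.comp ((hre _).prodMk (hre _))

lemma condEReal_ae_eq_condExp {f : X → ℝ} (hf : Integrable f μ) :
    condEReal mA μ f =ᵐ[μ] μ[f|mA] := by
  have hofReal {g : X → ℝ} (hg : Integrable g μ) :
      (fun x => (condLExp mA μ (fun y => ENNReal.ofReal (g y)) x).toReal) =ᵐ[μ]
        μ[fun x => (ENNReal.ofReal (g x)).toReal|mA] :=
    toReal_condLExp mA hg.1.aemeasurable.ennreal_ofReal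
      (ne_top_of_le_ne_top hg.2.ne (lintegral_ofReal_le_lintegral_enorm g))
  have hintegrable {g : X → ℝ} (hg : Integrable g μ) :
      Integrable (fun x => (ENNReal.ofReal (g x)).toReal) μ := by
    simpa only [ENNReal.toReal_ofReal'] using hg.pos_part
  filter_upwards [hofReal hf, hofReal hf.neg, condExp_sub (hintegrable hf) (hintegrable hf.neg) mA,
    condExp_congr_ae (m := mA) (μ := μ) (f := f) (.of_forall fun x =>
      (max_zero_sub_eq_self (f x)).symm)] with x hpos hneg hsub hparts
  simp only [ENNReal.toReal_ofReal'] at hpos hneg hsub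
  exact (congrArg₂ (· - ·) hpos hneg).trans (hsub.symm.trans hparts.symm)

lemma condE_ae_eq_condExp (hf : Integrable f μ) : condE mA μ f =ᵐ[μ] μ[f|mA] := by
  filter_upwards [condEReal_ae_eq_condExp (mA := mA) hf.re,
    condEReal_ae_eq_condExp (mA := mA) hf.im,
    Complex.reCLM.comp_condExp_comm (m := mA) hf, Complex.imCLM.comp_condExp_comm (m := mA) hf]
    with x hre him hre' him'
  exact Complex.ext (hre.trans hre'.symm) (him.trans him'.symm)

variable (hA : mA ≤ mF) [SigmaFinite (μ.trim hA)]
include hA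

lemma condLExp_indicator (hs : MeasurableSet[mA] s) (h : X → ℝ≥0∞) :
    condLExp mA μ (s.indicator h) =ᵐ[μ] s.indicator (condLExp mA μ h) := by
  refine EventuallyEq.symm (ae_eq_condLExp hA μ _
    ((measurable_condLExp mA μ h).indicator hs) fun t ht => ?_)
  rw [setLIntegral_indicator (hA _ hs), setLIntegral_indicator (hA _ hs),
    setLIntegral_condLExp hA μ h (hs.inter ht)]

lemma condEReal_indicator (hs : MeasurableSet[mA] s) (f : X → ℝ) :
    condEReal mA μ (s.indicator f) =ᵐ[μ] s.indicator (condEReal mA μ f) := by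
  have hpos : (fun y => ENNReal.ofReal (s.indicator f y)) =
      s.indicator fun y => ENNReal.ofReal (f y) :=
    (Set.indicator_comp_of_zero ENNReal.ofReal_zero).symm
  have hneg : (fun y => ENNReal.ofReal (-s.indicator f y)) =
      s.indicator fun y => ENNReal.ofReal (-f y) :=
    (Set.indicator_comp_of_zero (g := fun t => ENNReal.ofReal (-t)) (by simp)).symm
  filter_upwards [condLExp_indicator hA hs fun y => ENNReal.ofReal (f y),
    condLExp_indicator hA hs fun y => ENNReal.ofReal (-f y)] with x hx hx'
  rw [condEReal, hpos, hneg, hx, hx']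
  by_cases hxs : x ∈ s <;> simp [hxs, condEReal]

lemma condE_indicator (hs : MeasurableSet[mA] s) (f : X → ℂ) :
    condE mA μ (s.indicator f) =ᵐ[μ] s.indicator (condE mA μ f) := by
  have hre : (fun y => (s.indicator f y).re) = s.indicator fun y => (f y).re :=
    (Set.indicator_comp_of_zero Complex.zero_re).symm
  have him : (fun y => (s.indicator f y).im) = s.indicator fun y => (f y).im :=
    (Set.indicator_comp_of_zero Complex.zero_im).symm
  filter_upwards [condEReal_indicator hA hs fun y => (f y).re,
    condEReal_indicator hA hs fun y => (f y).im] with x hx hx'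
  rw [condE, hre, him, hx, hx']
  by_cases hxs : x ∈ s <;> simp [hxs, condE, Complex.ext_iff]

lemma condE_ae_eq_condExp_indicator (hs : MeasurableSet[mA] s) (hf : IntegrableOn f s μ) :
    condE mA μ f =ᵐ[μ.restrict s] μ[s.indicator f|mA] := by
  rw [Filter.EventuallyEq, ae_restrict_iff' (hA _ hs)]
  filter_upwards [condE_indicator hA hs f,
    condE_ae_eq_condExp (mA := mA) (hf.integrable_indicator (hA _ hs))] with x hx hx' hxs
  rw [← hx', hx, Set.indicator_of_mem hxs]

lemma integrableOn_condE (hs : MeasurableSet[mA] s) (hf : IntegrableOn f s μ) :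
    IntegrableOn (condE mA μ f) s μ :=
  integrable_condExp.integrableOn.congr (condE_ae_eq_condExp_indicator hA hs hf).symm

lemma setIntegral_condE (hs : MeasurableSet[mA] s) (hf : IntegrableOn f s μ) :
    ∫ x in s, condE mA μ f x ∂μ = ∫ x in s, f x ∂μ := by
  rw [integral_congr_ae (condE_ae_eq_condExp_indicator hA hs hf),
    setIntegral_condExp hA (hf.integrable_indicator (hA _ hs)) hs,
    setIntegral_indicator (hA _ hs), Set.inter_self]

lemma ae_of_forall_ae_restrict {p : X → Prop}
    (hp : ∀ s, MeasurableSet[mA] s → μ s < ∞ → ∀ᵐ x ∂μ.restrict s, p x) : ∀ᵐ x ∂μ, p x := by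
  rw [← Measure.restrict_univ (μ := μ), ← @iUnion_spanningSets X mA (μ.trim hA) _,
    ae_restrict_iUnion_iff]
  intro n
  have hs : MeasurableSet[mA] (@spanningSets X mA (μ.trim hA) _ n) := measurableSet_spanningSets _ n
  exact hp _ hs (trim_measurableSet_eq hA hs ▸ measure_spanningSets_lt_top (μ.trim hA) n)

lemma IntegrableOnFinite.conditionable (hfm : AEStronglyMeasurable f μ)
    (hf : IntegrableOnFinite mA μ f) : Conditionable mA μ f := by
  refine ⟨hfm, ae_of_forall_ae_restrict hA fun s hs hμs => ?_⟩
  have hfs : ∫⁻ x, s.indicator (fun y => ‖f y‖ₑ) x ∂μ ≠ ∞ := by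
    rw [lintegral_indicator (hA _ hs)]
    exact (hf s hs hμs).2.ne
  rw [ae_restrict_iff' (hA _ hs)]
  filter_upwards [condLExp_indicator hA hs fun y => ‖f y‖ₑ, condLExp_lt_top (mΩ := mA) hfs]
    with x hx hlt hxs
  rwa [hx, Set.indicator_of_mem hxs] at hlt

lemma ae_eq_condE (hf : IntegrableOnFinite mA μ f) (hg : IntegrableOnFinite mA μ g)
    (hgm : AEStronglyMeasurable[mA] g μ)
    (hgf : ∀ s, MeasurableSet[mA] s → μ s < ∞ → ∫ x in s, g x ∂μ = ∫ x in s, f x ∂μ) :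
    g =ᵐ[μ] condE mA μ f :=
  ae_eq_of_forall_setIntegral_eq_of_sigmaFinite' hA hg
    (fun s hs hμs => integrableOn_condE hA hs (hf s hs hμs))
    (fun s hs hμs => (hgf s hs hμs).trans (setIntegral_condE hA hs (hf s hs hμs)).symm)
    hgm (measurable_condE f).stronglyMeasurable.aestronglyMeasurable

lemma condE_mul_of_aestronglyMeasurable_left (hgm : AEStronglyMeasurable[mA] g μ)
    (hf : IntegrableOnFinite mA μ f) (hgf : IntegrableOnFinite mA μ fun x => g x * f x) :
    condE mA μ (fun x => g x * f x) =ᵐ[μ] fun x => g x * condE mA μ f x := by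
  refine ae_of_forall_ae_restrict hA fun s hs hμs => ?_
  have hmul : s.indicator (fun x => g x * f x) = fun x => g x * s.indicator f x :=
    funext fun x => Set.indicator_mul_right ..
  have hfs := (hf s hs hμs).integrable_indicator (hA _ hs)
  have hgfs := (hgf s hs hμs).integrable_indicator (hA _ hs)
  have hpull : μ[s.indicator fun x => g x * f x|mA] =ᵐ[μ]
      fun x => g x * (μ[s.indicator f|mA]) x := by
    rw [hmul] at hgfs ⊢
    exact condExp_bilin_of_aestronglyMeasurable_left (ContinuousLinearMap.mul ℝ ℂ) hgm hgfs hfs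
  filter_upwards [condE_ae_eq_condExp_indicator hA hs (hgf s hs hμs),
    condE_ae_eq_condExp_indicator hA hs (hf s hs hμs), ae_restrict_of_ae hpull] with x h₁ h₂ h₃
  rw [h₁, h₂, h₃]

end CondExp

section Operator

variable {X : Type*} {mA mF : MeasurableSpace X} {μ : Measure[mF] X}

lemma lintegral_mul_condLExp (hA : mA ≤ mF) [SigmaFinite (μ.trim hA)] {h f : X → ℝ≥0∞}
    (hh : Measurable[mA] h) (hf : AEMeasurable f μ) :
    ∫⁻ x, condLExp mA μ f x * h x ∂μ = ∫⁻ x, f x * h x ∂μ := by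
  have htrim : (μ.withDensity f).trim hA =
      @Measure.withDensity X mA (μ.trim hA) (condLExp mA μ f) := by
    refine @Measure.ext X mA _ _ fun s hs => ?_
    rw [trim_measurableSet_eq hA hs, withDensity_apply _ (hA s hs), withDensity_apply _ hs,
      setLIntegral_condLExp_trim hA μ f hs]
  calc ∫⁻ x, condLExp mA μ f x * h x ∂μ = ∫⁻ x, condLExp mA μ f x * h x ∂μ.trim hA :=
        (lintegral_trim hA ((measurable_condLExp mA μ f).mul hh)).symm
    _ = ∫⁻ x, h x ∂(μ.withDensity f).trim hA := by
        rw [htrim]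
        exact (lintegral_withDensity_eq_lintegral_mul _ (measurable_condLExp mA μ f) hh).symm
    _ = ∫⁻ x, h x ∂μ.withDensity f := lintegral_trim hA hh
    _ = ∫⁻ x, f x * h x ∂μ :=
        lintegral_withDensity_eq_lintegral_mul₀ hf (hh.mono hA le_rfl).aemeasurable

lemma eLpNorm_smul_le_of_condLExp_le {𝕜 E : Type*} [NormedField 𝕜] [NormedAddCommGroup E]
    [NormedSpace 𝕜 E] (hA : mA ≤ mF) [SigmaFinite (μ.trim hA)] {v : X → 𝕜} {g : X → E}
    {p C : ℝ≥0∞} (hp0 : p ≠ 0) (hp : p ≠ ∞) (hv : AEStronglyMeasurable v μ)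
    (hC : ∀ᵐ x ∂μ, condLExp mA μ (fun y => ‖v y‖ₑ ^ p.toReal) x ≤ C)
    (hg : AEStronglyMeasurable[mA] g μ) :
    eLpNorm (fun x => v x • g x) p μ ≤ C ^ (1 / p.toReal) * eLpNorm g p μ := by
  obtain ⟨g', hg', hgg'⟩ := hg
  have hp' : 0 < p.toReal := ENNReal.toReal_pos hp0 hp
  rw [eLpNorm_congr_ae (hgg'.mono fun x hx => congrArg (v x • ·) hx), eLpNorm_congr_ae hgg',
    eLpNorm_eq_lintegral_rpow_enorm_toReal hp0 hp, eLpNorm_eq_lintegral_rpow_enorm_toReal hp0 hp,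
    ← ENNReal.mul_rpow_of_nonneg _ _ (by positivity)]
  gcongr
  have hg'm : Measurable[mA] fun x => ‖g' x‖ₑ ^ p.toReal := hg'.enorm.pow_const _
  calc ∫⁻ x, ‖v x • g' x‖ₑ ^ p.toReal ∂μ
      = ∫⁻ x, ‖v x‖ₑ ^ p.toReal * ‖g' x‖ₑ ^ p.toReal ∂μ := by
        simp only [enorm_smul, ENNReal.mul_rpow_of_nonneg _ _ hp'.le]
    _ = ∫⁻ x, condLExp mA μ (fun y => ‖v y‖ₑ ^ p.toReal) x * ‖g' x‖ₑ ^ p.toReal ∂μ :=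
        (lintegral_mul_condLExp hA hg'm (hv.enorm.pow_const _)).symm
    _ ≤ ∫⁻ x, C * ‖g' x‖ₑ ^ p.toReal ∂μ := by
        refine lintegral_mono_ae ?_
        filter_upwards [hC] with x hx
        gcongr
    _ = C * ∫⁻ x, ‖g' x‖ₑ ^ p.toReal ∂μ := lintegral_const_mul C (hg'm.mono hA le_rfl)

lemma exists_clm_mul {𝕜 : Type*} [RCLike 𝕜] {p C : ℝ≥0∞} [Fact (1 ≤ p)]
    (V : Submodule 𝕜 (Lp 𝕜 p μ)) {v : X → 𝕜} (hv : AEStronglyMeasurable v μ) (hC : C ≠ ∞)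
    (hle : ∀ g ∈ V, eLpNorm (fun x => v x * g x) p μ ≤ C * eLpNorm g p μ) :
    ∃ B : V →L[𝕜] Lp 𝕜 p μ, ∀ g : V, B g =ᵐ[μ] fun x => v x * g.1 x := by
  have hlt (g : V) : C * eLpNorm g.1 p μ < ∞ :=
    ENNReal.mul_lt_top hC.lt_top (Lp.eLpNorm_lt_top g.1)
  have hmem (g : V) : MemLp (fun x => v x * g.1 x) p μ :=
    ⟨hv.mul (Lp.aestronglyMeasurable g.1), (hle g g.2).trans_lt (hlt g)⟩
  let L : V →ₗ[𝕜] Lp 𝕜 p μ :=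
    { toFun := fun g => (hmem g).toLp _
      map_add' := fun g h => by
        rw [← MemLp.toLp_add]
        refine MemLp.toLp_congr _ _ ?_
        filter_upwards [Lp.coeFn_add g.1 h.1] with x hx
        exact (congrArg (v x * ·) hx).trans (mul_add ..)
      map_smul' := fun c g => by
        rw [RingHom.id_apply, ← MemLp.toLp_const_smul]
        refine MemLp.toLp_congr _ _ ?_
        filter_upwards [Lp.coeFn_smul c g.1] with x hx
        exact (congrArg (v x * ·) hx).trans (mul_left_comm ..) }
  refine ⟨L.mkContinuous C.toReal fun g => ?_, fun g => (hmem g).coeFn_toLp⟩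
  change ‖(hmem g).toLp _‖ ≤ C.toReal * ‖g.1‖
  rw [Lp.norm_toLp, Lp.norm_def, ← ENNReal.toReal_mul]
  exact ENNReal.toReal_mono (hlt g).ne (hle g g.2)

lemma exists_clm_mul_lpMeas (hA : mA ≤ mF) [SigmaFinite (μ.trim hA)] {𝕜 : Type*} [RCLike 𝕜]
    {p : ℝ≥0∞} [Fact (1 ≤ p)] (hp : p ≠ ∞) {v : X → 𝕜} (hv : AEStronglyMeasurable v μ)
    (hbdd : essSup (condLExp mA μ fun x => ‖v x‖ₑ ^ p.toReal) μ < ∞) :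
    ∃ B : lpMeas 𝕜 𝕜 mA p μ →L[𝕜] Lp 𝕜 p μ, ∀ g, B g =ᵐ[μ] fun x => v x * g.1 x := by
  have hp0 : p ≠ 0 := (zero_lt_one.trans_le Fact.out).ne'
  refine exists_clm_mul (lpMeas 𝕜 𝕜 mA p μ) hv
    (ENNReal.rpow_ne_top_of_nonneg (y := 1 / p.toReal) (by positivity) hbdd.ne) fun g hg => ?_
  simpa only [smul_eq_mul] using eLpNorm_smul_le_of_condLExp_le (v := v) (g := g) hA hp0 hp hv
    (ENNReal.ae_le_essSup _) (mem_lpMeas_iff_aestronglyMeasurable.1 hg)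

variable {u w : X → ℂ}

section Adjoint

variable [hA : Fact (mA ≤ mF)] {B : lpMeas ℂ ℂ mA 2 μ →L[ℂ] Lp ℂ 2 μ}
  (hB : ∀ g, B g =ᵐ[μ] fun x => star (u x) * g.1 x) {s : Set X}
include hB

lemma indicator_mul_ae_eq_inner (hs : MeasurableSet[mA] s) (hμs : μ s ≠ ∞) (f : Lp ℂ 2 μ) :
    s.indicator (fun x => u x * f x) =ᵐ[μ] fun x =>
      inner ℂ (B ⟨_, mem_lpMeas_indicatorConstLp hA.out hs hμs (c := 1)⟩ x) (f x) := by
  filter_upwards [hB ⟨_, mem_lpMeas_indicatorConstLp hA.out hs hμs (c := 1)⟩,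
    indicatorConstLp_coeFn (p := 2) (hs := hA.out s hs) (hμs := hμs) (c := (1 : ℂ))] with x h₁ h₂
  rw [h₁, h₂]
  by_cases hx : x ∈ s <;> simp [hx, mul_comm]

lemma integrableOnFinite_mul (f : Lp ℂ 2 μ) : IntegrableOnFinite mA μ fun x => u x * f x := by
  intro s hs hμs
  rw [← integrable_indicator_iff (hA.out s hs)]
  exact (L2.integrable_inner _ f).congr (indicator_mul_ae_eq_inner hB hs hμs.ne f).symm

lemma setIntegral_adjoint_apply (hs : MeasurableSet[mA] s) (hμs : μ s ≠ ∞) (f : Lp ℂ 2 μ) :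
    ∫ x in s, (ContinuousLinearMap.adjoint B f).1 x ∂μ = ∫ x in s, u x * f x ∂μ := by
  rw [← L2.inner_indicatorConstLp_one (𝕜 := ℂ) (hA.out s hs) hμs,
    ← integral_indicator (hA.out s hs),
    integral_congr_ae (indicator_mul_ae_eq_inner hB hs hμs f)]
  exact ContinuousLinearMap.adjoint_inner_right B
    ⟨_, mem_lpMeas_indicatorConstLp hA.out hs hμs⟩ f

variable [SigmaFinite (μ.trim hA.out)]

lemma isWCE_one_subtypeL_comp_adjoint (hu : AEStronglyMeasurable u μ) :
    IsWCE mA μ (fun _ => 1) u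
      ((lpMeas ℂ ℂ mA 2 μ).subtypeL ∘L ContinuousLinearMap.adjoint B) := by
  intro f
  have huf := integrableOnFinite_mul hB f
  refine ⟨huf.conditionable hA.out (hu.mul (Lp.aestronglyMeasurable f)), ?_⟩
  simp only [one_mul]
  exact ae_eq_condE hA.out huf
    (fun s _ hμs => integrableOn_Lp_of_measure_ne_top _ one_le_two hμs.ne)
    (lpMeas.aestronglyMeasurable _) fun s hs hμs => setIntegral_adjoint_apply hB hs hμs.ne f

end Adjoint

lemma exists_isWCE_one (hA : mA ≤ mF) [SigmaFinite (μ.trim hA)] (hu : AEStronglyMeasurable u μ)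
    (hbdd : essSup (condLExp mA μ fun x => ‖u x‖ₑ ^ 2) μ < ∞) :
    ∃ A : Lp ℂ 2 μ →L[ℂ] Lp ℂ 2 μ, IsWCE mA μ (fun _ => 1) u A ∧
      ∀ f : Lp ℂ 2 μ, IntegrableOnFinite mA μ fun x => u x * f x := by
  have : Fact (mA ≤ mF) := ⟨hA⟩
  obtain ⟨B, hB⟩ := exists_clm_mul_lpMeas (p := 2) (v := fun x => star (u x)) hA
    ENNReal.ofNat_ne_top hu.star (by simpa using hbdd)
  exact ⟨_, isWCE_one_subtypeL_comp_adjoint hB hu, integrableOnFinite_mul hB⟩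

variable {A T : Lp ℂ 2 μ →L[ℂ] Lp ℂ 2 μ}

lemma IsWCE.apply_eq_zero (hAu : IsWCE mA μ (fun _ => 1) u A) (hT : IsWCE mA μ w u T)
    {f : Lp ℂ 2 μ} (hf : A f = 0) : T f = 0 := by
  apply Lp.ext
  filter_upwards [(hAu f).2, (hT f).2, Lp.coeFn_zero ℂ 2 μ] with x hAx hTx h0
  rw [hf, h0, Pi.zero_apply, one_mul] at hAx
  rw [hTx, ← hAx, mul_zero, h0, Pi.zero_apply]

variable (hA : mA ≤ mF)
include hA

lemma integrableOnFinite_of_forall_mul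
    (hu : ∀ f : Lp ℂ 2 μ, IntegrableOnFinite mA μ fun x => u x * f x) :
    IntegrableOnFinite mA μ u := by
  intro s hs hμs
  refine (hu (indicatorConstLp 2 (hA s hs) hμs.ne 1) s hs hμs).congr ?_
  rw [Filter.EventuallyEq, ae_restrict_iff' (hA s hs)]
  filter_upwards [indicatorConstLp_coeFn_mem (p := 2) (hs := hA s hs) (hμs := hμs.ne)
    (c := (1 : ℂ))] with x hx hxs
  rw [hx hxs, mul_one]

variable [SigmaFinite (μ.trim hA)]

lemma IsWCE.apply_ae_eq_mul_condE (hAu : IsWCE mA μ (fun _ => 1) u A)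
    (hu : ∀ f : Lp ℂ 2 μ, IntegrableOnFinite mA μ fun x => u x * f x) {g : Lp ℂ 2 μ}
    (hg : AEStronglyMeasurable[mA] g μ) : A g =ᵐ[μ] fun x => g x * condE mA μ u x := by
  have hcomm : (fun x => u x * g x) = fun x => g x * u x := funext fun x => mul_comm ..
  filter_upwards [(hAu g).2, condE_mul_of_aestronglyMeasurable_left hA hg
    (integrableOnFinite_of_forall_mul hA hu) (hcomm ▸ hu g)] with x hAx hpull
  rw [hAx, one_mul, hcomm, hpull]

lemma IsWCE.exists_apply_eq_norm_le (hAu : IsWCE mA μ (fun _ => 1) u A)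
    (hu : ∀ f : Lp ℂ 2 μ, IntegrableOnFinite mA μ fun x => u x * f x) {δ : ℝ} (hδ : 0 < δ)
    (hlow : ∀ᵐ x ∂μ, δ ≤ ‖condE mA μ u x‖) (f : Lp ℂ 2 μ) :
    ∃ g : Lp ℂ 2 μ, A g = A f ∧ ‖g‖ ≤ δ⁻¹ * ‖A f‖ := by
  let g : X → ℂ := fun x => condE mA μ (fun y => u y * f y) x * (condE mA μ u x)⁻¹
  have hgm : Measurable[mA] g := (measurable_condE _).mul (measurable_condE _).inv
  have hle : ∀ᵐ x ∂μ, ‖g x‖ ≤ δ⁻¹ * ‖A f x‖ := by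
    filter_upwards [hlow, (hAu f).2] with x hδx hAx
    rw [hAx, one_mul, norm_mul, norm_inv, mul_comm]
    gcongr
  have hg : MemLp g 2 μ :=
    (Lp.memLp (A f)).of_le_mul (hgm.mono hA le_rfl).aestronglyMeasurable hle
  have hg_toLp : AEStronglyMeasurable[mA] (hg.toLp g) μ :=
    ⟨g, hgm.stronglyMeasurable, hg.coeFn_toLp⟩
  refine ⟨hg.toLp g, Lp.ext ?_, Lp.norm_le_mul_norm_of_ae_le_mul ?_⟩
  · filter_upwards [hAu.apply_ae_eq_mul_condE hA hu hg_toLp, hg.coeFn_toLp, (hAu f).2, hlow]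
      with x hAg hgx hAf hδx
    have hne : condE mA μ u x ≠ 0 := norm_pos_iff.1 (hδ.trans_le hδx)
    rw [hAg, hgx, hAf, one_mul, inv_mul_cancel_right₀ hne]
  · filter_upwards [hle, hg.coeFn_toLp] with x hx hgx
    rwa [hgx]

end Operator

end SpectralRadiusAlgebra

open SpectralRadiusAlgebra in
theorem mainTheorem9_general {X : Type*} {mF : MeasurableSpace X} (μ : Measure[mF] X)
    (mA : MeasurableSpace X) (hA : mA ≤ mF) [SigmaFinite (μ.trim hA)] (w u : X → ℂ)
    (hu : AEStronglyMeasurable[mF] u μ)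
    (hu_bdd : essSup (condLExp mA μ (fun x => ‖u x‖ₑ ^ 2)) μ < ∞)
    (T : Lp ℂ 2 μ →L[ℂ] Lp ℂ 2 μ) (hT : IsWCE mA μ w u T)
    (δ : ℝ) (hδ : 0 < δ) (hu_lower : ∀ᵐ x ∂μ, δ ≤ ‖condE mA μ u x‖) :
    ∃ A : Lp ℂ 2 μ →L[ℂ] Lp ℂ 2 μ,
      IsWCE mA μ (fun _ => 1) u A ∧ ∀ S ∈ Qset T, Majorizes A S := by
  obtain ⟨A, hAu, hintegrable⟩ := exists_isWCE_one hA hu hu_bdd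
  exact ⟨A, hAu, fun S hS => majorizes_of_forall_exists_apply_eq
    (hAu.exists_apply_eq_norm_le hA hintegrable hδ hu_lower)
    fun f hf => apply_eq_zero_of_mem_Qset hS (hAu.apply_eq_zero hT hf)⟩

theorem mainTheorem9 {X : Type*} {mF : MeasurableSpace X} (μ : Measure[mF] X) [SigmaFinite μ]
    (mA : MeasurableSpace X) (hA : mA ≤ mF) [SigmaFinite (μ.trim hA)]
    (w u : X → ℂ)
    (hw : SpectralRadiusAlgebra.Conditionable mA μ w)
    (hu : SpectralRadiusAlgebra.Conditionable mA μ u)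
    (hu_bdd : essSup (condLExp mA μ (fun x => ‖u x‖ₑ ^ 2)) μ < ∞)
    (T : Lp ℂ 2 μ →L[ℂ] Lp ℂ 2 μ) (hT : SpectralRadiusAlgebra.IsWCE mA μ w u T)
    (hu_nonneg : ∀ᵐ x ∂μ, 0 ≤ u x)
    (δ : ℝ) (hδ : 0 < δ)
    (hu_lower : ∀ᵐ x ∂μ, (δ : ℂ) ≤ SpectralRadiusAlgebra.condE mA μ u x) :
    ∃ A : Lp ℂ 2 μ →L[ℂ] Lp ℂ 2 μ,
      SpectralRadiusAlgebra.IsWCE mA μ (fun _ => 1) u A ∧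
      ∀ S ∈ SpectralRadiusAlgebra.Qset T, SpectralRadiusAlgebra.Majorizes A S := by
  refine mainTheorem9_general μ mA hA w u hu.1 hu_bdd T hT δ hδ (hu_lower.mono fun x hx => ?_)
  exact (Complex.le_def.1 hx).1.trans (Complex.re_le_norm _)
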